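/- Let $d\ge 0$, let $\mathcal A$ be a finite non-empty alphabet, let $R=\prod_{i=1}^d\{0,\dots,L_i-1\}$ with integers $L_i\ge 2$, and let $Q=\mathrm{diag}(L_1,\dots,L_d)$. Let $\varrho:\mathcal A\to\mathcal A^R$ be a block substitution with columns $\varrho_{\boldsymbol i}:\mathcal A\to\mathcal A$, $a\mapsto\varrho(a)_{\boldsymbol i}$ ($\boldsymbol i\in R$). Put $R^{(k)}=\prod_{i}\{0,\dots,L_i^k-1\}$ and let $\varrho^k(a)\in\mathcal A^{R^{(k)}}$ be the $k$-th iterate, where $\varrho^{k+1}(a)$ arises from $\varrho^k(a)$ by replacing the letter $b$ at each position $\boldsymbol m$ by the block $\varrho(b)$ placed on $Q\boldsymbol m+R$. Let $\mathbb X_\varrho\subseteq\mathcal A^{\mathbb Z^d}$ be the subshift of all configurations each of whose finite patterns occurs, up to translation, in $\varrho^k(a)$ for some $k\ge1$ and $a\in\mathcal A$. With $(\sigma_{\boldsymbol n}x)_{\boldsymbol m}=x_{\boldsymbol n+\boldsymbol m}$ and $\mathcal G=\langle\sigma_{\boldsymbol e_1},\dots,\sigma_{\boldsymbol e_d}\rangle$,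 let $\mathcal S(\mathbb X_\varrho)$ and $\mathcal R(\mathbb X_\varrho)$ be the centraliser and the normaliser of $\mathcal G$ in the group of self-homeomorphisms of $\mathbb X_\varrho$. Assume that $\varrho$ is bijective (every column is a bijection of $\mathcal A$), primitive (for some $k\ge1$, every $\varrho^k(a)$ contains all letters) and aperiodic (for $x\in\mathbb X_\varrho$, $\sigma_{\boldsymbol n}x=x$ only if $\boldsymbol n=\boldsymbol 0$). Let $A\in\mathrm{GL}(d,\mathbb Z)$ be a signed permutation matrix (that is, $A\in W_d$, the hyperoctahedral group), let $|A|$ be the matrix of absolute values of its entries, and put $\boldsymbol v=\frac12(1,\dots,1)^T$ and $\boldsymbol x_1=Q\boldsymbol v-\boldsymbol v$. Assume that $AQ=QA$ and $|A|\boldsymbol x_1=\boldsymbol x_1$, so that $A^{(1)}(\boldsymbol i)=A(\boldsymbol i-\boldsymbol x_1)+|A|\boldsymbol x_1$ defines a map $A^{(1)}:R\to R$. Assume further that there is $\boldsymbol\ell\in R$ with $\varrho_{\boldsymbol\ell'}=\mathrm{id}$ for all $\boldsymbol\ell'$ in the orbit of $\boldsymbol\ell$ under $A^{(1)}$. Let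 $\pi$ be a permutation of $\mathcal A$ and let $\boldsymbol t\in\mathbb Z^d$. Then the map $f$ given by $$f(x)_{\boldsymbol n}=\pi\bigl(x_{A\boldsymbol n+\boldsymbol t}\bigr)\qquad(\boldsymbol n\in\mathbb Z^d)$$ defines an element of $\mathcal R(\mathbb X_\varrho)$ if and only if $$\pi^{-1}\circ\varrho_{\boldsymbol i}\circ\pi=\varrho_{A^{(1)}(\boldsymbol i)}\qquad\text{for all }\boldsymbol i\in R.$$ Moreover, if $A\ne\mathbb I$, then the same condition is necessary and sufficient for $f$ to define an extended symmetry, i.e. an element of $\mathcal R(\mathbb X_\varrho)\setminus\mathcal S(\mathbb X_\varrho)$. -/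

import Mathlib

open SymbolicDynamics.FullShift

/-! ### Groups attached to a `ℤ^d`-subshift -/

namespace SymbolicDynamics.FullShift.Subshift

variable {d : ℕ} {𝒜 : Type*} [TopologicalSpace 𝒜]

/-- The shift `σ_n`, `(σ_n x)_m = x_{n+m}`, as a self-homeomorphism of a `ℤ^d`-subshift. -/
def shiftHomeo (X : Subshift 𝒜 (Fin d → ℤ)) (n : Fin d → ℤ) : X.carrier ≃ₜ X.carrier where
  toFun x := ⟨shift n x.1, X.mapsTo n x.2⟩
  invFun x := ⟨shift (-n) x.1, X.mapsTo (-n) x.2⟩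
  left_inv x := by
    apply Subtype.ext
    funext m
    simp [shift]
  right_inv x := by
    apply Subtype.ext
    funext m
    simp [shift]
  continuous_toFun := by fun_prop
  continuous_invFun := by fun_prop

/-- The group `⟨σ_{e_1}, …, σ_{e_d}⟩` generated by the shifts, as a subgroup of the group of all
self-homeomorphisms of the subshift (multiplication is composition). -/
def shiftGroup (X : Subshift 𝒜 (Fin d → ℤ)) : Subgroup (X.carrier ≃ₜ X.carrier) :=
  Subgroup.closure (Set.range fun i : Fin d => X.shiftHomeo (Pi.single i 1))

/-- The symmetry group: the self-homeomorphisms commuting with the shift action. -/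
def symmetryGroup (X : Subshift 𝒜 (Fin d → ℤ)) : Subgroup (X.carrier ≃ₜ X.carrier) :=
  Subgroup.centralizer (X.shiftGroup : Set (X.carrier ≃ₜ X.carrier))

/-- The extended symmetry group: the normaliser of the shift group in the group of all
self-homeomorphisms. -/
def extendedSymmetryGroup (X : Subshift 𝒜 (Fin d → ℤ)) : Subgroup (X.carrier ≃ₜ X.carrier) :=
  Subgroup.normalizer (X.shiftGroup : Set (X.carrier ≃ₜ X.carrier))

/-- No element of the subshift has a non-zero period. -/
def IsAperiodic (X : Subshift 𝒜 (Fin d → ℤ)) : Prop :=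
  ∀ x ∈ X.carrier, ∀ n : Fin d → ℤ, shift n x = x → n = 0

end SymbolicDynamics.FullShift.Subshift

/-! ### Signed permutation matrices -/

/-- The `d`-dimensional hyperoctahedral group: the signed permutation matrices in `GL(d, ℤ)`. -/
def hyperoctahedralGroup (d : ℕ) : Subgroup (GL (Fin d) ℤ) where
  carrier := {A | ∃ (σ : Equiv.Perm (Fin d)) (ε : Fin d → ℤˣ),
    ∀ i j, A.1 i j = if j = σ i then (ε i : ℤ) else 0}
  one_mem' := ⟨1, 1, fun i j => by simp [Matrix.one_apply, eq_comm]⟩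
  mul_mem' := by
    rintro A B ⟨σ, ε, hA⟩ ⟨τ, δ, hB⟩
    refine ⟨τ * σ, fun i => ε i * δ (σ i), fun i j => ?_⟩
    simp only [Units.val_mul, Matrix.mul_apply, hA]
    rw [Finset.sum_eq_single (σ i)]
    · rw [hB, if_pos rfl, mul_ite, mul_zero]
      rfl
    · intro b _ hb
      simp [hb]
    · simp
  inv_mem' := by
    rintro A ⟨σ, ε, hA⟩
    refine ⟨σ⁻¹, fun i => ε (σ⁻¹ i), ?_⟩
    have hmul : A.1 * (Matrix.of fun i j => if j = σ⁻¹ i then (ε (σ⁻¹ i) : ℤ) else 0) = 1 := by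
      ext i j
      have h1 : ∀ u : ℤˣ, (u : ℤ) * u = 1 := fun u => by
        rw [← Units.val_mul, Int.units_mul_self, Units.val_one]
      rw [Matrix.mul_apply, Finset.sum_eq_single (σ i)]
      · simp [hA, Matrix.one_apply, h1, eq_comm]
      · intro b _ hb
        simp [hA, hb]
      · simp
    have hinv : (A⁻¹).1 = Matrix.of fun i j => if j = σ⁻¹ i then (ε (σ⁻¹ i) : ℤ) else 0 := by
      calc (A⁻¹).1 = (A⁻¹).1 * (A.1 * _) := by rw [hmul, mul_one]
        _ = _ := by rw [← mul_assoc, ← Units.val_mul, inv_mul_cancel, Units.val_one, one_mul]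
    intro i j
    rw [hinv]
    rfl

/-! ### Block substitutions -/

/-- A `d`-dimensional block substitution `ϱ : 𝒜 → 𝒜^R`, with rectangular support
`R = ∏ i, [0, L i - 1]` and all side lengths at least two. -/
structure BlockSubstitution (d : ℕ) (𝒜 : Type*) where
  L : Fin d → ℕ
  two_le : ∀ i, 2 ≤ L i
  toFun : 𝒜 → (∀ i, Fin (L i)) → 𝒜

namespace BlockSubstitution

variable {d : ℕ} {𝒜 : Type*}

/-- The support `R = ∏ i, [0, L i - 1]` of the images of letters. -/
abbrev Support (ϱ : BlockSubstitution d 𝒜) : Type := ∀ i, Fin (ϱ.L i)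

/-- The column `ϱ_j : a ↦ ϱ(a)_j`. -/
def column (ϱ : BlockSubstitution d 𝒜) (j : ϱ.Support) : 𝒜 → 𝒜 := fun a => ϱ.toFun a j

/-- All columns are bijections of the alphabet. -/
def IsBijective (ϱ : BlockSubstitution d 𝒜) : Prop :=
  ∀ j : ϱ.Support, Function.Bijective (ϱ.column j)

/-- The remainder of a position `n ∈ ℤ^d` modulo the side lengths, i.e. the unique `r ∈ R` with
`n ∈ Q ℤ^d + r`. -/
def rem (ϱ : BlockSubstitution d 𝒜) (n : Fin d → ℤ) : ϱ.Support := fun i =>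
  ⟨(n i % (ϱ.L i : ℤ)).toNat, by
    have h : (0 : ℤ) < ϱ.L i := by exact_mod_cast lt_of_lt_of_le two_pos (ϱ.two_le i)
    have := Int.emod_lt_of_pos (n i) h
    have := Int.emod_nonneg (n i) h.ne'
    omega⟩

/-- The set `R^(k) = ∏ i, [0, (L i)^k - 1]` of positions in a level-`k` supertile. -/
def box (ϱ : BlockSubstitution d 𝒜) (k : ℕ) : Set (Fin d → ℤ) :=
  {n | ∀ i, 0 ≤ n i ∧ n i < (ϱ.L i : ℤ) ^ k}

/-- The letter `ϱ^k(a)_n` of the level-`k` supertile `ϱ^k(a)` at the position `n ∈ R^(k)`.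
The supertile `ϱ^(k+1)(a)` arises from `ϱ^k(a)` by replacing the letter `b` at each position `m` by
the block `ϱ(b)` on `Q m + R`. Only the values at positions in `ϱ.box k` are meaningful. -/
def supertile (ϱ : BlockSubstitution d 𝒜) : ℕ → 𝒜 → (Fin d → ℤ) → 𝒜
  | 0, a, _ => a
  | k + 1, a, n => ϱ.column (ϱ.rem n) (ϱ.supertile k a fun i => n i / (ϱ.L i : ℤ))

/-- Some level-`k` supertile map sends each letter to a pattern containing all letters. -/
def IsPrimitive (ϱ : BlockSubstitution d 𝒜) : Prop :=
  ∃ k : ℕ, 1 ≤ k ∧ ∀ a b : 𝒜, ∃ n ∈ ϱ.box k, ϱ.supertile k a n = b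

/-- The pattern `x|_U` is legal: a translate of it is a subpattern of some `ϱ^k(a)`, `k ≥ 1`. -/
def IsLegal (ϱ : BlockSubstitution d 𝒜) (x : (Fin d → ℤ) → 𝒜) (U : Finset (Fin d → ℤ)) : Prop :=
  ∃ k : ℕ, 1 ≤ k ∧ ∃ (a : 𝒜) (p : Fin d → ℤ),
    ∀ u ∈ U, p + u ∈ ϱ.box k ∧ ϱ.supertile k a (p + u) = x u

/-- The substitutive subshift (hull) of `ϱ`: the configurations all of whose finite patterns are
legal. -/
def hull [TopologicalSpace 𝒜] [DiscreteTopology 𝒜] (ϱ : BlockSubstitution d 𝒜) :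
    Subshift 𝒜 (Fin d → ℤ) where
  carrier := {x | ∀ U : Finset (Fin d → ℤ), ϱ.IsLegal x U}
  isClosed := by
    rw [← isOpen_compl_iff, isOpen_iff_forall_mem_open]
    intro x hx
    simp only [Set.mem_compl_iff, Set.mem_ofPred_eq, not_forall] at hx
    obtain ⟨U, hU⟩ := hx
    refine ⟨cylinder U x, fun y hy hy' => hU ?_, isOpen_cylinder U x, fun _ _ => rfl⟩
    obtain ⟨k, hk, a, p, h⟩ := hy' U
    exact ⟨k, hk, a, p, fun u hu => ⟨(h u hu).1, (h u hu).2.trans (hy u hu)⟩⟩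
  mapsTo := by
    classical
    intro g x hx U
    obtain ⟨k, hk, a, p, h⟩ := hx (U.image (g + ·))
    refine ⟨k, hk, a, p + g, fun u hu => ?_⟩
    have := h (g + u) (Finset.mem_image_of_mem _ hu)
    rwa [← add_assoc] at this

/-- The expansive map `Q = diag(L_1, …, L_d)`. -/
def expansion (ϱ : BlockSubstitution d 𝒜) : Matrix (Fin d) (Fin d) ℤ :=
  Matrix.diagonal fun i => (ϱ.L i : ℤ)

/-- The centre `x_1 = Q v - v` of the level-one supertile, where `v = (1/2, …, 1/2)`. -/
def centre (ϱ : BlockSubstitution d 𝒜) : Fin d → ℚ :=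
  (ϱ.expansion.map (Int.cast : ℤ → ℚ)).mulVec (fun _ => 1 / 2) - fun _ => 1 / 2

/-- `|A| x_1`, where `|A|` is the entrywise absolute value of `A`. -/
def absCentre (ϱ : BlockSubstitution d 𝒜) (A : GL (Fin d) ℤ) : Fin d → ℚ :=
  (A.1.map fun z : ℤ => ((|z| : ℤ) : ℚ)).mulVec ϱ.centre

/-- The position `i ∈ R` as a vector in `ℚ^d`. -/
def position (ϱ : BlockSubstitution d 𝒜) (i : ϱ.Support) : Fin d → ℚ := fun s => ((i s : ℕ) : ℚ)

/-- The affine map `i ↦ A (i - x_1) + |A| x_1` preserves the support `R` if `A` is a signed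
permutation matrix with `|A| x_1 = x_1`. -/
theorem exists_position_eq (ϱ : BlockSubstitution d 𝒜) (A : GL (Fin d) ℤ)
    (hA : A ∈ hyperoctahedralGroup d) (hc : ϱ.absCentre A = ϱ.centre) (i : ϱ.Support) :
    ∃ j : ϱ.Support, ϱ.position j =
      (A.1.map (Int.cast : ℤ → ℚ)).mulVec (ϱ.position i - ϱ.centre) + ϱ.absCentre A := by
  obtain ⟨σ, ε, h⟩ := hA
  have hcen : ∀ s, ϱ.centre s = ((ϱ.L s : ℚ) - 1) / 2 := fun s => by
    simp [centre, expansion, Matrix.mulVec, dotProduct, Matrix.diagonal_apply]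
    ring
  have habs : ∀ s, ϱ.absCentre A s = ϱ.centre (σ s) := fun s => by
    have h1 : |((ε s : ℤˣ) : ℤ)| = 1 := Int.isUnit_iff_abs_eq.mp (ε s).isUnit
    simp only [absCentre, Matrix.mulVec, dotProduct, Matrix.map_apply, h]
    rw [Finset.sum_eq_single (σ s)]
    · simp [h1]
    · intro b _ hb
      simp [hb]
    · simp
  have hL : ∀ s, ϱ.L (σ s) = ϱ.L s := fun s => by
    have := congrFun hc s
    rw [habs, hcen, hcen] at this
    have h2 : (ϱ.L (σ s) : ℚ) = ϱ.L s := by linarith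
    exact_mod_cast h2
  refine ⟨fun s => if ε s = 1 then ⟨i (σ s), by rw [← hL s]; exact (i (σ s)).2⟩
    else ⟨ϱ.L s - 1 - i (σ s), by have := ϱ.two_le s; omega⟩, ?_⟩
  funext s
  have hsum : (A.1.map (Int.cast : ℤ → ℚ)).mulVec (ϱ.position i - ϱ.centre) s
      = ((ε s : ℤ) : ℚ) * (ϱ.position i (σ s) - ϱ.centre (σ s)) := by
    simp only [Matrix.mulVec, dotProduct, Matrix.map_apply, h]
    rw [Finset.sum_eq_single (σ s)]
    · simp
    · intro b _ hb
      simp [hb]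
    · simp
  rw [Pi.add_apply, hsum, habs, hcen]
  rcases Int.units_eq_one_or (ε s) with h1 | h1
  · simp [position, h1]
  · have hlt : (i (σ s) : ℕ) + 1 ≤ ϱ.L s := by rw [← hL s]; exact (i (σ s)).2
    have h3 : ((ϱ.L s - 1 - (i (σ s) : ℕ) : ℕ) : ℚ) = (ϱ.L s : ℚ) - 1 - (i (σ s) : ℕ) := by
      rw [Nat.cast_sub (by omega), Nat.cast_sub (by omega)]
      simp
    have h4 : ((-1 : ℤˣ) = 1) = False := by decide
    simp only [position, h1, h4, if_false, h3, hL]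
    push_cast
    ring

/-- The map `A^(1) : R → R`, `A^(1)(i) = A (i - x_1) + |A| x_1`. -/
noncomputable def supportMap (ϱ : BlockSubstitution d 𝒜) (A : GL (Fin d) ℤ)
    (hA : A ∈ hyperoctahedralGroup d) (hc : ϱ.absCentre A = ϱ.centre) (i : ϱ.Support) :
    ϱ.Support :=
  Classical.choose (ϱ.exists_position_eq A hA hc i)

theorem position_supportMap (ϱ : BlockSubstitution d 𝒜) (A : GL (Fin d) ℤ)
    (hA : A ∈ hyperoctahedralGroup d) (hc : ϱ.absCentre A = ϱ.centre) (i : ϱ.Support) :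
    ϱ.position (ϱ.supportMap A hA hc i) =
      (A.1.map (Int.cast : ℤ → ℚ)).mulVec (ϱ.position i - ϱ.centre) + ϱ.absCentre A :=
  Classical.choose_spec (ϱ.exists_position_eq A hA hc i)

/-- The orbit of `l` under `A^(1)`; as `A^(1)` is a permutation of the finite set `R`, forward
iterates suffice. -/
def supportOrbit (ϱ : BlockSubstitution d 𝒜) (A : GL (Fin d) ℤ)
    (hA : A ∈ hyperoctahedralGroup d) (hc : ϱ.absCentre A = ϱ.centre) (l : ϱ.Support) :
    Set ϱ.Support :=
  Set.range fun m : ℕ => (ϱ.supportMap A hA hc)^[m] l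

/-- The homeomorphism `f` of the hull is the composition of the letter exchange map `π`, the
rearrangement `x ↦ (x_{A n})_n` and the shift `σ_t`, i.e. `f(x)_n = π(x_{A n + t})`. -/
def IsInducedBy [TopologicalSpace 𝒜] [DiscreteTopology 𝒜] (ϱ : BlockSubstitution d 𝒜)
    (π : Equiv.Perm 𝒜) (A : GL (Fin d) ℤ) (t : Fin d → ℤ)
    (f : ϱ.hull.carrier ≃ₜ ϱ.hull.carrier) : Prop :=
  ∀ (x : ϱ.hull.carrier) (n : Fin d → ℤ), (f x).1 n = π (x.1 (A.1.mulVec n + t))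

end BlockSubstitution

/-! Sufficiency is geometric. Since `A` commutes with `Q`, the affine map `A^(1)` lifts level by
level to an affine bijection of each box `R^(k)`. The column identity, equivalently `π ∘
ϱ_{A^(1)(i)} = ϱ_i ∘ π`, then says that rearranging `ϱ^k(a)` by this bijection and relabelling by
`π` gives `ϱ^k(π a)`. So `f` preserves legality in both directions (`mem_hull_iff_of_intertwines`),
and `f σ_{An} = σ_n f` puts it in the normaliser.

Necessity rests on recognisability of the grid. Apply `f` to a translate of `ϱ(y)` chosen so that
the image carries `π(ϱ_{A^(1)(r)}(y_{Am}))` at `Qm + r`. The image lies in the hull, so it is also a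
translate of some `ϱ(z)` (`exists_eq_inflate`). If the two grids were displaced, bijectivity would
let each letter of `m ↦ y_{Am}` determine its successor in some coordinate direction, which forces a
period (`eq_rem_zero_of_forall_eq_inflate`). Hence the grids agree and `π(ϱ_{A^(1)(r)}(y_{Am})) =
ϱ_r(z_m)`. The identity columns at `l` and `A^(1)(l)` give `z_m = π(y_{Am})`, and a `y` using every
letter yields the identity on all of `𝒜`.

An induced map commuting with all shifts would give `σ_{An} x = σ_n x`, so aperiodicity forces `A =
1`; this gives the last claim. -/

/-! ### The shift group and its normaliser -/

namespace SymbolicDynamics.FullShift.Subshift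

variable {d : ℕ} {𝒜 : Type*} [TopologicalSpace 𝒜]

/-- The shift action as a homomorphism into the group of self-homeomorphisms. -/
def shiftHom (X : Subshift 𝒜 (Fin d → ℤ)) :
    Multiplicative (Fin d → ℤ) →* (X.carrier ≃ₜ X.carrier) where
  toFun n := X.shiftHomeo n.toAdd
  map_one' := by
    refine Homeomorph.ext fun x => Subtype.ext (funext fun m => ?_)
    simp [shiftHomeo]
  map_mul' a b := by
    refine Homeomorph.ext fun x => Subtype.ext (funext fun m => ?_)
    exact congrArg x.1 (show a.toAdd + b.toAdd + m = b.toAdd + (a.toAdd + m) by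
      rw [add_comm a.toAdd, add_assoc])

/-- Every integer vector is an integer combination of unit vectors, so the closure of the generators
is already the range of `shiftHom`. -/
theorem mem_shiftGroup_iff (X : Subshift 𝒜 (Fin d → ℤ)) (g : X.carrier ≃ₜ X.carrier) :
    g ∈ X.shiftGroup ↔ ∃ n, X.shiftHomeo n = g := by
  constructor
  · intro hg
    have hle : X.shiftGroup ≤ X.shiftHom.range := by
      rw [shiftGroup, Subgroup.closure_le]
      rintro _ ⟨i, rfl⟩
      exact ⟨Multiplicative.ofAdd (Pi.single i 1), rfl⟩
    obtain ⟨n, hn⟩ := hle hg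
    exact ⟨n.toAdd, hn⟩
  · rintro ⟨n, rfl⟩
    have hn : Multiplicative.ofAdd n
        = ∏ i, Multiplicative.ofAdd (Pi.single i (1 : ℤ) : Fin d → ℤ) ^ (n i) := by
      apply Multiplicative.toAdd.injective
      rw [toAdd_prod]
      funext j
      simp [Finset.sum_apply, Pi.single_apply]
    have hmem : Multiplicative.ofAdd n ∈ X.shiftGroup.comap X.shiftHom := by
      rw [hn]
      refine Subgroup.prod_mem _ fun i _ => Subgroup.zpow_mem _ ?_ _
      exact Subgroup.subset_closure (Set.mem_range_self i)
    exact hmem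

end SymbolicDynamics.FullShift.Subshift

/-! ### Positions, cells and inflation -/

namespace BlockSubstitution

variable {d : ℕ} {𝒜 : Type*} (ϱ : BlockSubstitution d 𝒜)

/-- The expanded position `Q m`. -/
def scale (m : Fin d → ℤ) : Fin d → ℤ := fun i => ϱ.L i * m i

/-- The position `i ∈ R` as a vector in `ℤ^d`. -/
def offset (r : ϱ.Support) : Fin d → ℤ := fun i => ((r i : ℕ) : ℤ)

/-- The index `m` of the cell `Q m + R` containing `n`. -/
def cell (n : Fin d → ℤ) : Fin d → ℤ := fun i => n i / (ϱ.L i : ℤ)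

/-- The action of the substitution on configurations. -/
def inflate (x : (Fin d → ℤ) → 𝒜) : (Fin d → ℤ) → 𝒜 := fun n => ϱ.column (ϱ.rem n) (x (ϱ.cell n))

theorem L_pos (i : Fin d) : (0 : ℤ) < ϱ.L i := by
  exact_mod_cast lt_of_lt_of_le two_pos (ϱ.two_le i)

theorem offset_injective : Function.Injective ϱ.offset := fun r s h => by
  funext i
  have := congrFun h i
  simp only [offset] at this
  exact Fin.ext (by exact_mod_cast this)

theorem offset_rem_apply (n : Fin d → ℤ) (i : Fin d) : ϱ.offset (ϱ.rem n) i = n i % ϱ.L i :=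
  Int.toNat_of_nonneg (Int.emod_nonneg _ (ϱ.L_pos i).ne')

theorem scale_cell_add_offset_rem (n : Fin d → ℤ) :
    ϱ.scale (ϱ.cell n) + ϱ.offset (ϱ.rem n) = n := by
  funext i
  rw [Pi.add_apply, offset_rem_apply]
  exact Int.mul_ediv_add_emod _ _

theorem cell_scale_add (m n : Fin d → ℤ) : ϱ.cell (ϱ.scale m + n) = m + ϱ.cell n := by
  funext i
  simp only [cell, scale, Pi.add_apply]
  rw [add_comm, Int.add_mul_ediv_left _ _ (ϱ.L_pos i).ne', add_comm]

theorem rem_scale_add (m n : Fin d → ℤ) : ϱ.rem (ϱ.scale m + n) = ϱ.rem n := by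
  apply ϱ.offset_injective
  funext i
  rw [offset_rem_apply, offset_rem_apply]
  simp [scale]

theorem rem_offset (r : ϱ.Support) : ϱ.rem (ϱ.offset r) = r := by
  apply ϱ.offset_injective
  funext i
  rw [offset_rem_apply]
  exact Int.emod_eq_of_lt (by simp [offset]) (by simp [offset])

theorem cell_offset (r : ϱ.Support) : ϱ.cell (ϱ.offset r) = 0 := by
  funext i
  exact Int.ediv_eq_zero_of_lt (by simp [offset]) (by simp [offset])

/-- `ϱ.rem 0` plays the role of the zero of `R` throughout. -/
theorem offset_rem_zero : ϱ.offset (ϱ.rem 0) = 0 := by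
  funext i
  rw [offset_rem_apply]
  simp

theorem inflate_scale_add_offset (x : (Fin d → ℤ) → 𝒜) (m : Fin d → ℤ) (r : ϱ.Support) :
    ϱ.inflate x (ϱ.scale m + ϱ.offset r) = ϱ.column r (x m) := by
  rw [inflate, rem_scale_add, cell_scale_add, rem_offset, cell_offset, add_zero]

theorem supertile_succ (k : ℕ) (a : 𝒜) :
    ϱ.supertile (k + 1) a = ϱ.inflate (ϱ.supertile k a) := rfl

theorem scale_add_offset_mem_box (k : ℕ) (m : Fin d → ℤ) (r : ϱ.Support) :
    ϱ.scale m + ϱ.offset r ∈ ϱ.box (k + 1) ↔ m ∈ ϱ.box k := by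
  refine forall_congr' fun i => ?_
  have hL := ϱ.L_pos i
  have hr : ((r i : ℕ) : ℤ) < ϱ.L i := by exact_mod_cast (r i).2
  have hr0 : (0 : ℤ) ≤ (r i : ℕ) := by positivity
  simp only [scale, offset, Pi.add_apply, pow_succ']
  refine and_congr ⟨fun h => ?_, fun h => by positivity⟩ ⟨fun h => ?_, fun h => ?_⟩
  · by_contra! h'
    nlinarith
  · exact lt_of_mul_lt_mul_left (by linarith) hL.le
  · nlinarith [mul_le_mul_of_nonneg_left (Int.add_one_le_iff.mpr h) hL.le]

theorem mem_box_succ_iff (k : ℕ) (n : Fin d → ℤ) : n ∈ ϱ.box (k + 1) ↔ ϱ.cell n ∈ ϱ.box k := by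
  conv_lhs => rw [← ϱ.scale_cell_add_offset_rem n]
  exact ϱ.scale_add_offset_mem_box k _ _

theorem scale_eq_expansion_mulVec (m : Fin d → ℤ) : ϱ.scale m = ϱ.expansion.mulVec m := by
  funext i
  simp [scale, expansion, Matrix.mulVec_diagonal]

theorem scale_add (m n : Fin d → ℤ) : ϱ.scale (m + n) = ϱ.scale m + ϱ.scale n := by
  funext i
  simp [scale, mul_add]

/-- Passing `k` times from a position in `R^(k)` to its cell ends at the origin, so only `x 0`
matters there. -/
theorem iterate_inflate_eq_supertile (x : (Fin d → ℤ) → 𝒜) (k : ℕ) :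
    ∀ n ∈ ϱ.box k, ϱ.inflate^[k] x n = ϱ.supertile k (x 0) n := by
  induction k with
  | zero =>
    intro n hn
    have : n = 0 := by
      funext i
      have := hn i
      simp only [pow_zero] at this
      simp only [Pi.zero_apply]
      omega
    simp [this, supertile]
  | succ k ih =>
    intro n hn
    rw [Function.iterate_succ_apply', supertile_succ, inflate, inflate,
      ih _ ((ϱ.mem_box_succ_iff k n).mp hn)]

/-! ### Configurations in the hull -/

section Hull

variable [TopologicalSpace 𝒜] [DiscreteTopology 𝒜]

theorem inflate_mem_hull {x : (Fin d → ℤ) → 𝒜} (hx : x ∈ ϱ.hull.carrier) :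
    ϱ.inflate x ∈ ϱ.hull.carrier := by
  classical
  intro U
  obtain ⟨k, hk, a, p, h⟩ := hx (U.image ϱ.cell)
  refine ⟨k + 1, by omega, a, ϱ.scale p, fun u hu => ?_⟩
  obtain ⟨h1, h2⟩ := h _ (Finset.mem_image_of_mem _ hu)
  rw [mem_box_succ_iff, supertile_succ, inflate, inflate, rem_scale_add, cell_scale_add, h2]
  exact ⟨h1, rfl⟩

/-- Compactness: legality on a finite `U` is a closed condition, and these conditions are directed
under unions of the sets `U`. -/
theorem hull_nonempty [Finite 𝒜] [Nonempty 𝒜] : ϱ.hull.carrier.Nonempty := by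
  classical
  have hcpt : CompactSpace 𝒜 := Finite.compactSpace
  have hdet : ∀ (U : Finset (Fin d → ℤ)) (x y : (Fin d → ℤ) → 𝒜), y ∈ cylinder U x →
      ϱ.IsLegal y U → ϱ.IsLegal x U := by
    rintro U x y hy ⟨k, hk, a, p, h⟩
    exact ⟨k, hk, a, p, fun u hu => ⟨(h u hu).1, (h u hu).2.trans (hy u hu)⟩⟩
  have hclosed : ∀ U : Finset (Fin d → ℤ), IsClosed {x : (Fin d → ℤ) → 𝒜 | ϱ.IsLegal x U} := by
    intro U
    rw [← isOpen_compl_iff, isOpen_iff_forall_mem_open]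
    exact fun x hx => ⟨cylinder U x, fun y hy hy' => hx (hdet U x y hy hy'), isOpen_cylinder U x,
      fun _ _ => rfl⟩
  have hne : ∀ U : Finset (Fin d → ℤ), {x : (Fin d → ℤ) → 𝒜 | ϱ.IsLegal x U}.Nonempty := by
    intro U
    obtain ⟨N, hN⟩ : ∃ N : ℕ, ∀ u ∈ U, ∀ i, |u i| ≤ N := by
      refine ⟨∑ u ∈ U, ∑ i, (u i).natAbs, fun u hu i => ?_⟩
      rw [Int.abs_eq_natAbs]
      exact_mod_cast (Finset.single_le_sum (f := fun i => (u i).natAbs) (fun _ _ => Nat.zero_le _)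
        (Finset.mem_univ i)).trans (Finset.single_le_sum (f := fun u : Fin d → ℤ =>
          ∑ i, (u i).natAbs) (fun _ _ => Nat.zero_le _) hu)
    -- The sides of the level-`(2N+1)` box exceed `2N+1`, so it contains the cube `[-N, N]^d`
    -- translated by `(N, …, N)`.
    refine ⟨fun n => ϱ.supertile (2 * N + 1) (Classical.arbitrary 𝒜) ((fun _ => (N : ℤ)) + n),
      2 * N + 1, by omega, Classical.arbitrary 𝒜, fun _ => N, fun u hu => ⟨fun i => ?_, rfl⟩⟩
    have h1 := abs_le.mp (hN u hu i)
    have h2 : 2 * N + 1 < ϱ.L i ^ (2 * N + 1) :=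
      Nat.lt_two_pow_self.trans_le (Nat.pow_le_pow_left (ϱ.two_le i) _)
    have h3 : (2 * N + 1 : ℤ) < (ϱ.L i : ℤ) ^ (2 * N + 1) := by exact_mod_cast h2
    simp only [Pi.add_apply]
    omega
  have hmono : ∀ {U V : Finset (Fin d → ℤ)}, U ⊆ V →
      {x : (Fin d → ℤ) → 𝒜 | ϱ.IsLegal x V} ⊆ {x | ϱ.IsLegal x U} := by
    rintro U V hUV x ⟨k, hk, a, p, h⟩
    exact ⟨k, hk, a, p, fun u hu => h u (hUV hu)⟩
  obtain ⟨x, hx⟩ := IsCompact.nonempty_iInter_of_directed_nonempty_isCompact_isClosed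
    (fun U : Finset (Fin d → ℤ) => {x : (Fin d → ℤ) → 𝒜 | ϱ.IsLegal x U})
    (fun U V => ⟨U ∪ V, hmono Finset.subset_union_left, hmono Finset.subset_union_right⟩)
    hne (fun U => (hclosed U).isCompact) hclosed
  exact ⟨x, fun U => Set.mem_iInter.mp hx U⟩

/-- For a primitive substitution, the hull has an element in which all letters occur. -/
theorem exists_mem_hull_surjective [Finite 𝒜] [Nonempty 𝒜] (hprim : ϱ.IsPrimitive) :
    ∃ x ∈ ϱ.hull.carrier, Function.Surjective x := by
  obtain ⟨x, hx⟩ := ϱ.hull_nonempty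
  obtain ⟨k, -, h⟩ := hprim
  refine ⟨ϱ.inflate^[k] x, ?_, fun b => ?_⟩
  · exact Set.MapsTo.iterate (fun _ hy => ϱ.inflate_mem_hull hy) k hx
  · obtain ⟨n, hn, hb⟩ := h (x 0) b
    exact ⟨n, (ϱ.iterate_inflate_eq_supertile x k n hn).trans hb⟩

/-- Every element of the hull of a bijective substitution is a translate of an inflated
configuration. -/
theorem exists_eq_inflate (hbij : ϱ.IsBijective) {x : (Fin d → ℤ) → 𝒜}
    (hx : x ∈ ϱ.hull.carrier) :
    ∃ (s : ϱ.Support) (z : (Fin d → ℤ) → 𝒜), ∀ n, x n = ϱ.inflate z (n + ϱ.offset s) := by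
  classical
  have hfin : ∀ U : Finset (Fin d → ℤ), ∃ (s : ϱ.Support) (z : (Fin d → ℤ) → 𝒜),
      ∀ u ∈ U, x u = ϱ.inflate z (u + ϱ.offset s) := by
    intro U
    obtain ⟨k, hk, a, p, h⟩ := hx U
    obtain ⟨k, rfl⟩ : ∃ j, k = j + 1 := ⟨k - 1, by omega⟩
    refine ⟨ϱ.rem p, fun m => ϱ.supertile k a (ϱ.cell p + m), fun u hu => ?_⟩
    rw [← (h u hu).2, supertile_succ]
    have hp : p + u = ϱ.scale (ϱ.cell p) + (u + ϱ.offset (ϱ.rem p)) := by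
      conv_lhs => rw [← ϱ.scale_cell_add_offset_rem p]
      abel
    rw [hp, inflate, inflate, rem_scale_add, cell_scale_add]
  -- There are finitely many displacements: if each failed on some finite set, all would fail on the
  -- union of these sets.
  obtain ⟨s, hs⟩ : ∃ s : ϱ.Support, ∀ U : Finset (Fin d → ℤ), ∃ z : (Fin d → ℤ) → 𝒜,
      ∀ u ∈ U, x u = ϱ.inflate z (u + ϱ.offset s) := by
    by_contra! hcon
    choose U hU using hcon
    obtain ⟨s, z, hz⟩ := hfin (Finset.univ.biUnion U)
    obtain ⟨u, hu, hne⟩ := hU s z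
    exact hne (hz u (Finset.mem_biUnion.mpr ⟨s, Finset.mem_univ s, hu⟩))
  -- The local preimages glue because bijectivity of the first column recovers `z m` from the letter
  -- of `x` at the corner of its cell.
  refine ⟨s, fun m => (Equiv.ofBijective _ (hbij (ϱ.rem 0))).symm (x (ϱ.scale m - ϱ.offset s)),
    fun n => ?_⟩
  obtain ⟨z, hz⟩ := hs {n, ϱ.scale (ϱ.cell (n + ϱ.offset s)) - ϱ.offset s}
  have h1 := hz n (by simp)
  have h2 := hz (ϱ.scale (ϱ.cell (n + ϱ.offset s)) - ϱ.offset s) (by simp)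
  have h3 := ϱ.inflate_scale_add_offset z (ϱ.cell (n + ϱ.offset s)) (ϱ.rem 0)
  rw [offset_rem_zero, add_zero] at h3
  rw [sub_add_cancel, h3] at h2
  rw [h1, inflate, inflate, h2]
  exact congrArg _ (Equiv.ofBijective_symm_apply_apply _ (hbij (ϱ.rem 0)) _).symm

end Hull

/-! ### Alignment of inflated configurations -/

/-- A configuration over a finite alphabet in which every letter determines its `e`-successor is
periodic. -/
theorem exists_period_of_successor [Finite 𝒜] {G : Type*} [AddCommGroup G] (w : G → 𝒜) (e : G)
    (h : ∀ m m', w m = w m' → w (m + e) = w (m' + e)) :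
    ∃ p : ℕ, 0 < p ∧ ∀ n, w (n + p • e) = w n := by
  obtain ⟨τ, hτ⟩ : ∃ τ : 𝒜 → 𝒜, ∀ m, w (m + e) = τ (w m) :=
    ⟨Function.extend w (fun m => w (m + e)) id, fun m =>
      (Function.FactorsThrough.extend_apply (f := w) (fun _ _ => h _ _) _ m).symm⟩
  have hiter : ∀ (p : ℕ) (m : G), w (m + p • e) = τ^[p] (w m) := by
    intro p
    induction p with
    | zero => simp
    | succ p ih =>
      intro m
      rw [succ_nsmul, ← add_assoc, hτ, ih, Function.iterate_succ_apply']
  -- There are finitely many self-maps of `𝒜`, so two iterates coincide; starting `i` steps before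
  -- `n` turns this into a period `j - i`, without `τ` being injective.
  obtain ⟨i, j, hij, heq⟩ : ∃ i j : ℕ, i < j ∧ τ^[i] = τ^[j] := by
    obtain ⟨i, j, hne, heq⟩ := Finite.exists_ne_map_eq_of_infinite fun p : ℕ => τ^[p]
    rcases lt_or_gt_of_ne hne with hlt | hlt
    · exact ⟨i, j, hlt, heq⟩
    · exact ⟨j, i, hlt, heq.symm⟩
  refine ⟨j - i, by omega, fun n => ?_⟩
  have h1 := hiter i (n - i • e)
  have h2 := hiter j (n - i • e)
  rw [sub_add_cancel] at h1
  rw [h1, heq, ← h2]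
  congr 1
  have : j • e = (j - i) • e + i • e := by rw [← add_nsmul, Nat.sub_add_cancel hij.le]
  rw [this]
  abel

/-- If a translate of an inflated configuration is constant up to bijections on the cells of the
unshifted grid, and the underlying configuration has no periods in coordinate directions, then
the two grids coincide. -/
theorem eq_rem_zero_of_forall_eq_inflate [Finite 𝒜] (hbij : ϱ.IsBijective)
    (α : ϱ.Support → 𝒜 → 𝒜) (hα : ∀ r, Function.Injective (α r)) (w z : (Fin d → ℤ) → 𝒜)
    (s : ϱ.Support)
    (h : ∀ m r, α r (w m) = ϱ.inflate z (ϱ.scale m + ϱ.offset r + ϱ.offset s))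
    (hw : ∀ (j : Fin d) (p : ℕ), 0 < p → ¬ ∀ n, w (n + p • Pi.single j 1) = w n) :
    s = ϱ.rem 0 := by
  apply ϱ.offset_injective
  rw [offset_rem_zero]
  by_contra hs
  obtain ⟨j, hj⟩ := Function.ne_iff.mp hs
  have hj0 : (s j : ℕ) ≠ 0 := fun h0 => hj (by simp [offset, h0])
  -- The last position of a cell, displaced by `s j ≥ 1`, lands in the next cell of the other grid,
  -- at `L j - 1 + s j = L j + (s j - 1)`.
  set s' : ϱ.Support := Function.update s j ⟨s j - 1, by omega⟩
  set r' : ϱ.Support := Function.update (ϱ.rem 0) j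
    ⟨ϱ.L j - 1, by have := ϱ.two_le j; omega⟩
  have hcast : ((s j - 1 : ℕ) : ℤ) = (s j : ℕ) - 1 := by omega
  have hcast' : ((ϱ.L j - 1 : ℕ) : ℤ) = (ϱ.L j : ℕ) - 1 := by have := ϱ.two_le j; omega
  have hpos : ∀ m, ϱ.scale m + ϱ.offset r' + ϱ.offset s
      = ϱ.scale (m + Pi.single j 1) + ϱ.offset s' := by
    intro m
    funext i
    have h0 := congrFun ϱ.offset_rem_zero i
    simp only [offset] at h0
    by_cases hi : i = j
    · subst hi
      simp only [scale, offset, s', r', Pi.add_apply, Pi.single_eq_same, Function.update_self,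
        hcast, hcast']
      ring
    · simp only [scale, offset, s', r', Pi.add_apply, Pi.single_eq_of_ne hi,
        Function.update_of_ne hi, h0, Pi.zero_apply, add_zero]
  have hlast : ∀ m, α r' (w m) = ϱ.column s' (z (m + Pi.single j 1)) := fun m => by
    rw [h, hpos, inflate_scale_add_offset]
  have hfirst : ∀ m, α (ϱ.rem 0) (w m) = ϱ.column s (z m) := fun m => by
    rw [h, offset_rem_zero, add_zero, inflate_scale_add_offset]
  obtain ⟨p, hp, hper⟩ := exists_period_of_successor w (Pi.single j 1) fun m m' hmm' => by
    apply hα (ϱ.rem 0)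
    rw [hfirst, hfirst]
    congr 1
    apply (hbij s').injective
    rw [← hlast, ← hlast, hmm']
  exact hw j p hp hper

/-! ### Signed permutation matrices acting on cells and supertiles -/

section Geometry

variable {ϱ} {A : GL (Fin d) ℤ}

theorem mulVec_inv_mulVec (A : GL (Fin d) ℤ) (n : Fin d → ℤ) :
    A.1.mulVec ((A⁻¹).1.mulVec n) = n := by
  rw [Matrix.mulVec_mulVec, ← Units.val_mul, mul_inv_cancel, Units.val_one, Matrix.one_mulVec]

theorem inv_mulVec_mulVec (A : GL (Fin d) ℤ) (n : Fin d → ℤ) :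
    (A⁻¹).1.mulVec (A.1.mulVec n) = n := by
  rw [Matrix.mulVec_mulVec, ← Units.val_mul, inv_mul_cancel, Units.val_one, Matrix.one_mulVec]

theorem mulVec_scale (hcomm : Commute A.1 ϱ.expansion) (m : Fin d → ℤ) :
    A.1.mulVec (ϱ.scale m) = ϱ.scale (A.1.mulVec m) := by
  rw [scale_eq_expansion_mulVec, scale_eq_expansion_mulVec, Matrix.mulVec_mulVec,
    Matrix.mulVec_mulVec, hcomm.eq]

variable (ϱ A) in
/-- The image of the origin under `A^(1)`. -/
noncomputable def corner (hA : A ∈ hyperoctahedralGroup d) (hc : ϱ.absCentre A = ϱ.centre) :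
    Fin d → ℤ :=
  ϱ.offset (ϱ.supportMap A hA hc (ϱ.rem 0))

/-- Comparing with the image of the origin cancels the half-integral centre and leaves an affine map
over `ℤ`. -/
theorem offset_supportMap (hA : A ∈ hyperoctahedralGroup d) (hc : ϱ.absCentre A = ϱ.centre)
    (r : ϱ.Support) :
    ϱ.offset (ϱ.supportMap A hA hc r) = A.1.mulVec (ϱ.offset r) + ϱ.corner A hA hc := by
  have hpos : ∀ r : ϱ.Support, ϱ.position r = fun i => ((ϱ.offset r i : ℤ) : ℚ) := fun r => by
    funext i
    simp [position, offset]
  have h0 : ϱ.position (ϱ.rem 0) = 0 := by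
    rw [hpos, offset_rem_zero]
    funext i
    simp
  have h1 := ϱ.position_supportMap A hA hc r
  have h2 := ϱ.position_supportMap A hA hc (ϱ.rem 0)
  rw [h0] at h2
  funext i
  have h3 := congrFun h1 i
  have h4 := congrFun h2 i
  have h5 : (A.1.map (Int.cast : ℤ → ℚ)).mulVec (ϱ.position r) i
      = ((A.1.mulVec (ϱ.offset r) i : ℤ) : ℚ) := by
    rw [hpos]
    simp [Matrix.mulVec, dotProduct]
  rw [Matrix.mulVec_sub, Pi.add_apply, Pi.sub_apply, h5] at h3
  rw [Matrix.mulVec_sub, Matrix.mulVec_zero, Pi.add_apply, Pi.sub_apply, Pi.zero_apply] at h4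
  rw [hpos] at h3 h4
  have h6 : ((ϱ.offset (ϱ.supportMap A hA hc r) i : ℤ) : ℚ)
      = ((A.1.mulVec (ϱ.offset r) i : ℤ) : ℚ)
        + (ϱ.offset (ϱ.supportMap A hA hc (ϱ.rem 0)) i : ℤ) := by
    linarith
  exact_mod_cast h6

variable (ϱ A) in
/-- The translation part of the affine map with linear part `A` that preserves `R^(k)`. -/
noncomputable def corners (hA : A ∈ hyperoctahedralGroup d) (hc : ϱ.absCentre A = ϱ.centre) :
    ℕ → Fin d → ℤ
  | 0 => 0
  | k + 1 => ϱ.scale (corners hA hc k) + ϱ.corner A hA hc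

theorem mulVec_scale_add_offset (hA : A ∈ hyperoctahedralGroup d)
    (hc : ϱ.absCentre A = ϱ.centre) (hcomm : Commute A.1 ϱ.expansion) (m : Fin d → ℤ)
    (r : ϱ.Support) :
    A.1.mulVec (ϱ.scale m + ϱ.offset r) + ϱ.corner A hA hc
      = ϱ.scale (A.1.mulVec m) + ϱ.offset (ϱ.supportMap A hA hc r) := by
  rw [Matrix.mulVec_add, mulVec_scale hcomm, offset_supportMap, add_assoc]

theorem mulVec_scale_add_offset_add_corners (hA : A ∈ hyperoctahedralGroup d)
    (hc : ϱ.absCentre A = ϱ.centre) (hcomm : Commute A.1 ϱ.expansion) (k : ℕ) (m : Fin d → ℤ)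
    (r : ϱ.Support) :
    A.1.mulVec (ϱ.scale m + ϱ.offset r) + ϱ.corners A hA hc (k + 1)
      = ϱ.scale (A.1.mulVec m + ϱ.corners A hA hc k) + ϱ.offset (ϱ.supportMap A hA hc r) := by
  rw [corners, add_left_comm, mulVec_scale_add_offset hA hc hcomm, scale_add]
  abel

theorem mulVec_add_corners_mem_box (hA : A ∈ hyperoctahedralGroup d)
    (hc : ϱ.absCentre A = ϱ.centre) (hcomm : Commute A.1 ϱ.expansion) (k : ℕ) (n : Fin d → ℤ) :
    A.1.mulVec n + ϱ.corners A hA hc k ∈ ϱ.box k ↔ n ∈ ϱ.box k := by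
  induction k generalizing n with
  | zero =>
    have hbox : ∀ m : Fin d → ℤ, m ∈ ϱ.box 0 ↔ m = 0 := fun m => by
      simp only [box, pow_zero, Set.mem_ofPred_eq, funext_iff, Pi.zero_apply]
      exact forall_congr' fun i => by omega
    rw [hbox, hbox, corners, add_zero]
    refine ⟨fun h => ?_, fun h => by rw [h, Matrix.mulVec_zero]⟩
    rw [← inv_mulVec_mulVec A n, h, Matrix.mulVec_zero]
  | succ k ih =>
    rw [← ϱ.scale_cell_add_offset_rem n, mulVec_scale_add_offset_add_corners hA hc hcomm,
      scale_add_offset_mem_box, scale_add_offset_mem_box, ih]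

theorem supertile_mulVec_add_corners (hA : A ∈ hyperoctahedralGroup d)
    (hc : ϱ.absCentre A = ϱ.centre) (hcomm : Commute A.1 ϱ.expansion) {π : Equiv.Perm 𝒜}
    (hπ : ∀ i a, π (ϱ.column (ϱ.supportMap A hA hc i) a) = ϱ.column i (π a)) (k : ℕ) (a : 𝒜)
    (n : Fin d → ℤ) :
    π (ϱ.supertile k a (A.1.mulVec n + ϱ.corners A hA hc k)) = ϱ.supertile k (π a) n := by
  induction k generalizing n with
  | zero => rfl
  | succ k ih =>
    rw [← ϱ.scale_cell_add_offset_rem n, mulVec_scale_add_offset_add_corners hA hc hcomm,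
      supertile_succ, supertile_succ, inflate_scale_add_offset, inflate_scale_add_offset, hπ, ih]

/-- If `π` intertwines the columns, then the induced map on configurations preserves the hull and
its complement. -/
theorem mem_hull_iff_of_intertwines [TopologicalSpace 𝒜] [DiscreteTopology 𝒜]
    (hA : A ∈ hyperoctahedralGroup d)
    (hc : ϱ.absCentre A = ϱ.centre) (hcomm : Commute A.1 ϱ.expansion) {π : Equiv.Perm 𝒜}
    (hπ : ∀ i a, π (ϱ.column (ϱ.supportMap A hA hc i) a) = ϱ.column i (π a)) (t : Fin d → ℤ)
    (x : (Fin d → ℤ) → 𝒜) :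
    (fun n => π (x (A.1.mulVec n + t))) ∈ ϱ.hull.carrier ↔ x ∈ ϱ.hull.carrier := by
  classical
  constructor
  · intro h U
    obtain ⟨k, hk, a, p, hp⟩ := h (U.image fun u => (A⁻¹).1.mulVec (u - t))
    -- The supertile map carries the occurrence of the image pattern at `p` in `ϱ^k(a)` back to
    -- `ϱ^k(π⁻¹ a)`; the term `-t` compensates for the shift in `f`.
    refine ⟨k, hk, π.symm a, A.1.mulVec p - t + ϱ.corners A hA hc k, fun u hu => ?_⟩
    obtain ⟨h1, h2⟩ := hp _ (Finset.mem_image_of_mem _ hu)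
    have hu' : A.1.mulVec p - t + ϱ.corners A hA hc k + u
        = A.1.mulVec (p + (A⁻¹).1.mulVec (u - t)) + ϱ.corners A hA hc k := by
      rw [Matrix.mulVec_add, mulVec_inv_mulVec]
      abel
    rw [hu', mulVec_add_corners_mem_box hA hc hcomm]
    refine ⟨h1, π.injective ?_⟩
    rw [supertile_mulVec_add_corners hA hc hcomm hπ, Equiv.apply_symm_apply, h2]
    simp only [mulVec_inv_mulVec, sub_add_cancel]
  · intro h U
    obtain ⟨k, hk, a, p, hp⟩ := h (U.image fun u => A.1.mulVec u + t)
    refine ⟨k, hk, π a, (A⁻¹).1.mulVec (p + t - ϱ.corners A hA hc k), fun u hu => ?_⟩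
    obtain ⟨h1, h2⟩ := hp _ (Finset.mem_image_of_mem _ hu)
    have hu' : A.1.mulVec ((A⁻¹).1.mulVec (p + t - ϱ.corners A hA hc k) + u)
        + ϱ.corners A hA hc k = p + (A.1.mulVec u + t) := by
      rw [Matrix.mulVec_add, mulVec_inv_mulVec]
      abel
    rw [← mulVec_add_corners_mem_box hA hc hcomm, ← supertile_mulVec_add_corners hA hc hcomm hπ,
      hu', h2]
    exact ⟨h1, rfl⟩

end Geometry

/-! ### Homeomorphisms induced by a letter exchange and a rearrangement -/

section Induced

variable [TopologicalSpace 𝒜] [DiscreteTopology 𝒜] {ϱ} {A : GL (Fin d) ℤ} {π : Equiv.Perm 𝒜}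
  {t : Fin d → ℤ}

theorem exists_isInducedBy (hA : A ∈ hyperoctahedralGroup d)
    (hc : ϱ.absCentre A = ϱ.centre) (hcomm : Commute A.1 ϱ.expansion)
    (hπ : ∀ i a, π (ϱ.column (ϱ.supportMap A hA hc i) a) = ϱ.column i (π a)) :
    ∃ f, ϱ.IsInducedBy π A t f := by
  have hmem := fun x => mem_hull_iff_of_intertwines hA hc hcomm hπ t x
  have hcont : ∀ τ : 𝒜 → 𝒜, Continuous τ := fun τ => continuous_of_discreteTopology
  refine ⟨{
    toFun := fun x => ⟨fun n => π (x.1 (A.1.mulVec n + t)), (hmem x.1).mpr x.2⟩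
    invFun := fun y => ⟨fun n => π.symm (y.1 ((A⁻¹).1.mulVec (n - t))), (hmem _).mp (by simp)⟩
    left_inv := fun x => Subtype.ext (funext fun n => by simp)
    right_inv := fun x => Subtype.ext (funext fun n => by simp)
    continuous_toFun := ?_
    continuous_invFun := ?_ }, fun x n => rfl⟩
  · exact Continuous.subtype_mk (continuous_pi fun n => (hcont π).comp
      ((continuous_apply _).comp continuous_subtype_val)) _
  · exact Continuous.subtype_mk (continuous_pi fun n => (hcont π.symm).comp
      ((continuous_apply _).comp continuous_subtype_val)) _

theorem IsInducedBy.mul_shiftHomeo {f : ϱ.hull.carrier ≃ₜ ϱ.hull.carrier}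
    (hf : ϱ.IsInducedBy π A t f) (n : Fin d → ℤ) :
    f * ϱ.hull.shiftHomeo (A.1.mulVec n) = ϱ.hull.shiftHomeo n * f := by
  refine Homeomorph.ext fun x => Subtype.ext (funext fun m => ?_)
  rw [Homeomorph.mul_apply, Homeomorph.mul_apply, hf]
  change π (x.1 (A.1.mulVec n + (A.1.mulVec m + t))) = (f x).1 (n + m)
  rw [hf, Matrix.mulVec_add, add_assoc]

theorem IsInducedBy.mem_extendedSymmetryGroup {f : ϱ.hull.carrier ≃ₜ ϱ.hull.carrier}
    (hf : ϱ.IsInducedBy π A t f) : f ∈ ϱ.hull.extendedSymmetryGroup := by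
  rw [Subshift.extendedSymmetryGroup, Subgroup.mem_normalizer_iff']
  intro g
  rw [Subshift.mem_shiftGroup_iff, Subshift.mem_shiftGroup_iff]
  constructor
  · rintro ⟨n, hn⟩
    refine ⟨(A⁻¹).1.mulVec n, mul_right_cancel (b := f) ?_⟩
    rw [← hf.mul_shiftHomeo, mulVec_inv_mulVec, hn, mul_assoc]
  · rintro ⟨n, hn⟩
    refine ⟨A.1.mulVec n, mul_left_cancel (a := f) ?_⟩
    rw [hf.mul_shiftHomeo, hn, mul_assoc]

/-- An induced homeomorphism that commutes with the shifts has trivial linear part. -/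
theorem IsInducedBy.eq_one_of_mem_symmetryGroup [Finite 𝒜] [Nonempty 𝒜]
    (hap : ϱ.hull.IsAperiodic) {f : ϱ.hull.carrier ≃ₜ ϱ.hull.carrier}
    (hf : ϱ.IsInducedBy π A t f) (hsymm : f ∈ ϱ.hull.symmetryGroup) : A = 1 := by
  have hfix : ∀ n, A.1.mulVec n = n := by
    intro n
    have h1 := Subgroup.mem_centralizer_iff.mp hsymm (ϱ.hull.shiftHomeo n)
      ((Subshift.mem_shiftGroup_iff _ _).mpr ⟨n, rfl⟩)
    rw [← hf.mul_shiftHomeo n] at h1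
    have h2 := mul_left_cancel h1
    obtain ⟨x, hx⟩ := ϱ.hull_nonempty
    have h3 : shift (A.1.mulVec n) x = shift n x :=
      congrArg Subtype.val (DFunLike.congr_fun h2 (⟨x, hx⟩ : ϱ.hull.carrier))
    -- Equal shifts of `x` make the difference `An - n` a period.
    have h4 := hap x hx (-n + A.1.mulVec n) (by
      funext m
      have := congrFun h3 (-n + m)
      simp only [shift_apply] at this ⊢
      rw [add_neg_cancel_left] at this
      rw [← this]
      congr 1
      abel)
    exact (neg_add_eq_zero.mp h4).symm
  apply Units.ext
  apply Matrix.ext_of_mulVec_single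
  intro i
  rw [hfix, Units.val_one, Matrix.one_mulVec]

theorem IsInducedBy.intertwines [Finite 𝒜] [Nonempty 𝒜] (hap : ϱ.hull.IsAperiodic)
    (hprim : ϱ.IsPrimitive) (hbij : ϱ.IsBijective) (hA : A ∈ hyperoctahedralGroup d)
    (hc : ϱ.absCentre A = ϱ.centre) (hcomm : Commute A.1 ϱ.expansion)
    {l : ϱ.Support} (hl : ϱ.column l = id) (hl' : ϱ.column (ϱ.supportMap A hA hc l) = id)
    {f : ϱ.hull.carrier ≃ₜ ϱ.hull.carrier} (hf : ϱ.IsInducedBy π A t f) (i : ϱ.Support) (a : 𝒜) :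
    π (ϱ.column (ϱ.supportMap A hA hc i) a) = ϱ.column i (π a) := by
  obtain ⟨y, hy, hsurj⟩ := ϱ.exists_mem_hull_surjective hprim
  -- This translate cancels `t` and adds the corner, so `f` reads `ϱ(y)` at `An + corner`, where `A`
  -- maps cells onto cells.
  have hx : shift (ϱ.corner A hA hc - t) (ϱ.inflate y) ∈ ϱ.hull.carrier :=
    ϱ.hull.mapsTo _ (ϱ.inflate_mem_hull hy)
  obtain ⟨s, z, hz⟩ := ϱ.exists_eq_inflate hbij (f ⟨_, hx⟩).2
  have hcol : ∀ m r, π (ϱ.column (ϱ.supportMap A hA hc r) (y (A.1.mulVec m)))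
      = ϱ.inflate z (ϱ.scale m + ϱ.offset r + ϱ.offset s) := by
    intro m r
    rw [← hz, hf]
    change _ = π (ϱ.inflate y (ϱ.corner A hA hc - t + _))
    rw [ ← inflate_scale_add_offset,
      ← mulVec_scale_add_offset hA hc hcomm]
    congr 2
    abel
  have hs : s = ϱ.rem 0 := by
    refine ϱ.eq_rem_zero_of_forall_eq_inflate hbij
      (fun r b => π (ϱ.column (ϱ.supportMap A hA hc r) b))
      (fun r => π.injective.comp (hbij _).injective) (fun m => y (A.1.mulVec m)) z s hcol ?_
    -- A period `p e_j` of `m ↦ y_{Am}` is a period `A(p e_j)` of `y`, hence zero.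
    intro j p hp hper
    have h0 := hap y hy (A.1.mulVec (p • Pi.single j 1)) (by
      funext n
      have := hper ((A⁻¹).1.mulVec n)
      rwa [Matrix.mulVec_add, mulVec_inv_mulVec, add_comm] at this)
    have h1 := congrArg (fun v => (A⁻¹).1.mulVec v j) h0
    simp only [inv_mulVec_mulVec, Matrix.mulVec_zero] at h1
    simp at h1
    omega
  subst hs
  have hcol' : ∀ m r, π (ϱ.column (ϱ.supportMap A hA hc r) (y (A.1.mulVec m)))
      = ϱ.column r (z m) := by
    intro m r
    rw [hcol, offset_rem_zero, add_zero, inflate_scale_add_offset]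
  obtain ⟨n, rfl⟩ := hsurj a
  have hn := hcol' ((A⁻¹).1.mulVec n)
  simp only [mulVec_inv_mulVec] at hn
  have hz' := hn l
  rw [hl, hl', id, id] at hz'
  rw [hn, hz']

end Induced

end BlockSubstitution

theorem mainTheorem3 {d : ℕ} {𝒜 : Type*} [Finite 𝒜] [Nonempty 𝒜] [TopologicalSpace 𝒜]
    [DiscreteTopology 𝒜] (ϱ : BlockSubstitution d 𝒜) (hap : ϱ.hull.IsAperiodic)
    (hprim : ϱ.IsPrimitive) (hbij : ϱ.IsBijective) (A : GL (Fin d) ℤ)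
    (hA : A ∈ hyperoctahedralGroup d) (hcomm : Commute A.1 ϱ.expansion)
    (hc : ϱ.absCentre A = ϱ.centre)
    (hid : ∃ l : ϱ.Support, ∀ l' ∈ ϱ.supportOrbit A hA hc l, ϱ.column l' = id)
    (π : Equiv.Perm 𝒜) (t : Fin d → ℤ) :
    ((∃ f ∈ ϱ.hull.extendedSymmetryGroup, ϱ.IsInducedBy π A t f) ↔
      ∀ i : ϱ.Support, ⇑π⁻¹ ∘ ϱ.column i ∘ ⇑π = ϱ.column (ϱ.supportMap A hA hc i)) ∧
    (A ≠ 1 →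
      ((∃ f ∈ ϱ.hull.extendedSymmetryGroup,
          f ∉ ϱ.hull.symmetryGroup ∧ ϱ.IsInducedBy π A t f) ↔
        ∀ i : ϱ.Support, ⇑π⁻¹ ∘ ϱ.column i ∘ ⇑π = ϱ.column (ϱ.supportMap A hA hc i))) := by
  obtain ⟨l, hl⟩ := hid
  have hiff : (∀ i : ϱ.Support, ⇑π⁻¹ ∘ ϱ.column i ∘ ⇑π = ϱ.column (ϱ.supportMap A hA hc i)) ↔
      ∀ i a, π (ϱ.column (ϱ.supportMap A hA hc i) a) = ϱ.column i (π a) := by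
    refine forall_congr' fun i => funext_iff.trans (forall_congr' fun a => ?_)
    rw [Function.comp_apply, Function.comp_apply, Equiv.Perm.inv_eq_iff_eq, eq_comm]
  rw [hiff]
  have hnec : ∀ f, ϱ.IsInducedBy π A t f →
      ∀ i a, π (ϱ.column (ϱ.supportMap A hA hc i) a) = ϱ.column i (π a) := fun f hf =>
    -- Only the first two points of the orbit, `l` and `A^(1)(l)`, are needed.
    hf.intertwines hap hprim hbij hA hc hcomm (hl l ⟨0, rfl⟩) (hl _ ⟨1, rfl⟩)
  refine ⟨⟨fun ⟨f, _, hf⟩ => hnec f hf, fun h => ?_⟩,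
    fun hA1 => ⟨fun ⟨f, _, _, hf⟩ => hnec f hf, fun h => ?_⟩⟩
  · obtain ⟨f, hf⟩ := BlockSubstitution.exists_isInducedBy (t := t) hA hc hcomm h
    exact ⟨f, hf.mem_extendedSymmetryGroup, hf⟩
  · obtain ⟨f, hf⟩ := BlockSubstitution.exists_isInducedBy (t := t) hA hc hcomm h
    exact ⟨f, hf.mem_extendedSymmetryGroup, fun hs => hA1 (hf.eq_one_of_mem_symmetryGroup hap hs),
      hf⟩
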